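/- Conventions. A compact space is a non-empty compact Hausdorff space; $C(X)$ is the algebra of continuous complex-valued functions on a compact space $X$ with the uniform norm. A uniform algebra on $X$ is a closed subalgebra of $C(X)$ that contains the constants and separates the points of $X$. For a continuous map $\Pi:Y\to X$ put $\Pi^*(g)=g\circ\Pi$. Let $A$ be a uniform algebra on a compact space $X$ and $B$ a uniform algebra on a compact space $Y$. $B$ is a generalised Cole extension of $A$ with associated maps $\Pi:Y\to X$ and $T:C(Y)\to C(X)$ if $\Pi$ is a continuous surjection and $T$ is a unital linear map with $\|T\|=1$, $T\circ\Pi^*=\mathrm{id}_{C(X)}$ and $T(B)=A$. This extension is implemented by a compact (Hausdorff) group $G$, with normalised Haar measure $\mu$, if $G$ acts (jointly) continuously on $Y$, $G\cdot y=\Pi^{-1}(\{\Pi(y)\})$ for all $y\in Y$, and $T(f)(\Pi(y))=\int_G f(s\cdot y)\,d\mu(s)$ for all $f\in B$ and $y\in Y$. For a monic polynomial $q(t)=t^n+h_{n-1}t^{n-1}+\dots+h_0$ with coefficients in $A$, put $X^q=\{(x,z)\in X\times\mathbb C: z^n+h_{n-1}(x)z^{n-1}+\dots+h_0(x)=0\}$,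 let $\Pi_q:X^q\to X$ and $p_q:X^q\to\mathbb C$ be the restrictions of the coordinate projections, and let the Cole extension $A^q$ be the closure in $C(X^q)$ of the algebra generated by $p_q$ and the functions $f\circ\Pi_q$ $(f\in A)$. Theorem. Suppose that $B$ is a generalised Cole extension of $A$ with associated maps $\Pi:Y\to X$ and $T:C(Y)\to C(X)$, and that $\|\mathrm{id}_{C(Y)}-\Pi^*\circ T\|=1$. Then: (1) There is a homeomorphism $\rho:Y\to Y$ with $\rho\circ\rho=\mathrm{id}_Y$ and $\rho\neq\mathrm{id}_Y$ such that the extension is implemented by the two-element group $G=\{\mathrm{id}_Y,\rho\}$ (under composition, with the discrete topology and its natural action on $Y$). (2) If $h_0\in B$ satisfies $T(h_0)=0$ and $B$ is the uniform algebra generated by $\Pi^*(A)$ and $h_0$ (that is, the closure in $C(Y)$ of the algebra generated by $\Pi^*(A)\cup\{h_0\}$), then there exist $h\in A$ and, with $q(t)=t^2-h$, a homeomorphism $\psi:Y\to X^q$ such that $\Pi_q\circ\psi=\Pi$, $\psi^*(A^q)=B$ and $\psi^*(p_q)=h_0$. -/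

import Mathlib

noncomputable section

/-- A uniform algebra on a compact Hausdorff space `X`: a closed subalgebra of `C(X, ℂ)` which
separates the points of `X` (it contains the constants, being a unital `Subalgebra`). -/
structure IsUniformAlgebra {X : Type*} [TopologicalSpace X] (A : Subalgebra ℂ C(X, ℂ)) : Prop where
  isClosed : IsClosed (A : Set C(X, ℂ))
  separatesPoints : A.SeparatesPoints

/-- The pull-back `Π* : C(X) → C(Y)`, `Π*(g) = g ∘ Π`, as a bounded linear map. -/
def pullback {X Y : Type*} [TopologicalSpace X] [CompactSpace X] [TopologicalSpace Y]
    [CompactSpace Y] (Pi : C(Y, X)) : C(X, ℂ) →L[ℂ] C(Y, ℂ) where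
  toLinearMap := (ContinuousMap.compRightAlgHom ℂ ℂ Pi).toLinearMap
  cont := ContinuousMap.compRightAlgHom_continuous ℂ ℂ Pi

/-- `B` is a generalised Cole extension of `A` with associated maps `Π : Y → X` and
`T : C(Y) → C(X)`. -/
structure IsGeneralisedColeExtension {X Y : Type*} [TopologicalSpace X] [CompactSpace X]
    [TopologicalSpace Y] [CompactSpace Y] (A : Subalgebra ℂ C(X, ℂ)) (B : Subalgebra ℂ C(Y, ℂ))
    (Pi : C(Y, X)) (T : C(Y, ℂ) →L[ℂ] C(X, ℂ)) : Prop where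
  surjective : Function.Surjective Pi
  map_one : T 1 = 1
  norm_eq_one : ‖T‖ = 1
  comp_pullback : T.comp (pullback Pi) = ContinuousLinearMap.id ℂ C(X, ℂ)
  image_eq : T '' (B : Set C(Y, ℂ)) = (A : Set C(X, ℂ))

/-- The normalised Haar measure of a compact group, on its Borel `σ`-algebra. -/
def normalisedHaar (G : Type*) [Group G] [TopologicalSpace G] [IsTopologicalGroup G]
    [CompactSpace G] : @MeasureTheory.Measure G (borel G) :=
  letI : MeasurableSpace G := borel G
  haveI : BorelSpace G := ⟨rfl⟩
  MeasureTheory.Measure.haarMeasure (⊤ : TopologicalSpace.PositiveCompacts G)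

/-- The generalised Cole extension `B` of `A`, with associated maps `Π` and `T`, is implemented
by the compact (Hausdorff, topological) group `G`, which acts on `Y`. -/
structure IsImplementedBy {X Y : Type*} [TopologicalSpace X] [CompactSpace X]
    [TopologicalSpace Y] [CompactSpace Y] (A : Subalgebra ℂ C(X, ℂ)) (B : Subalgebra ℂ C(Y, ℂ))
    (Pi : C(Y, X)) (T : C(Y, ℂ) →L[ℂ] C(X, ℂ))
    (G : Type*) [Group G] [TopologicalSpace G] [MulAction G Y] : Prop where
  isGeneralisedColeExtension : IsGeneralisedColeExtension A B Pi T
  isTopologicalGroup : IsTopologicalGroup G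
  compactSpace : CompactSpace G
  t2Space : T2Space G
  /-- The action of `G` on `Y` is jointly continuous. -/
  continuousSMul : ContinuousSMul G Y
  /-- The orbits are the fibres of `Π`. -/
  orbit_eq : ∀ y : Y, MulAction.orbit G y = Pi ⁻¹' {Pi y}
  /-- On `B`, the map `T` is given by averaging over `G`. -/
  apply_eq_integral : ∀ f ∈ B, ∀ y : Y,
    T f (Pi y) = @MeasureTheory.integral G ℂ _ _ (borel G) (normalisedHaar G) fun s => f (s • y)

/-- The tautological action of the group of self-homeomorphisms of `Y`, under composition;
subgroups act by restriction. -/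
instance homeomorphMulAction (Y : Type*) [TopologicalSpace Y] : MulAction (Y ≃ₜ Y) Y where
  smul s y := s y
  one_smul _ := rfl
  mul_smul _ _ _ := rfl

section ColeExtension

variable {X : Type*} [TopologicalSpace X] {A : Subalgebra ℂ C(X, ℂ)}

/-- Evaluation at `x`, as a homomorphism `A → ℂ`. -/
def evalAt (A : Subalgebra ℂ C(X, ℂ)) (x : X) : A →+* ℂ where
  toFun f := (f : C(X, ℂ)) x
  map_zero' := rfl
  map_one' := rfl
  map_add' _ _ := rfl
  map_mul' _ _ := rfl

/-- `X^q = {(x, z) ∈ X × ℂ : q evaluated at x vanishes at z}`, for a polynomial `q` over `A`. -/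
def coleSpace (q : Polynomial A) : Set (X × ℂ) :=
  {p | q.eval₂ (evalAt A p.1) p.2 = 0}

theorem isClosed_coleSpace (q : Polynomial A) : IsClosed (coleSpace q) := by
  refine isClosed_eq ?_ continuous_const
  simp only [Polynomial.eval₂_eq_sum_range]
  refine continuous_finsetSum _ fun i _ => Continuous.mul ?_ (continuous_snd.pow i)
  exact ((q.coeff i : A) : C(X, ℂ)).continuous.comp continuous_fst

instance coleSpace_locallyCompactSpace [CompactSpace X] [T2Space X] (q : Polynomial A) :
    LocallyCompactSpace (coleSpace q) :=
  (isClosed_coleSpace q).locallyCompactSpace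

/-- The coordinate projection `Π_q : X^q → X`. -/
def coleProj (q : Polynomial A) : C(coleSpace q, X) where
  toFun p := p.1.1
  continuous_toFun := by fun_prop

/-- The coordinate projection `p_q : X^q → ℂ`. -/
def coleRoot (q : Polynomial A) : C(coleSpace q, ℂ) where
  toFun p := p.1.2
  continuous_toFun := by fun_prop

/-- The Cole extension `A^q`: the closure in `C(X^q)` of the algebra generated by `p_q` and the
functions `f ∘ Π_q`, `f ∈ A`. For `q` monic, `X^q` is compact, so the
topology of `C(X^q, ℂ)` is that of uniform convergence. -/
def coleExtension [CompactSpace X] [T2Space X] (q : Polynomial A) : Subalgebra ℂ C(coleSpace q, ℂ) :=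
  (Algebra.adjoin ℂ
    (insert (coleRoot q) ((fun f : C(X, ℂ) => f.comp (coleProj q)) '' (A : Set C(X, ℂ))))
    ).topologicalClosure

/-- The monic polynomial `q(t) = t² - h = t² + (-h)` over `A`. -/
def sqMinus (h : A) : Polynomial A :=
  Polynomial.X ^ 2 + Polynomial.C (-h)

end ColeExtension

end

/-! For each `x`, the functional `f ↦ T f x` is unital of norm at most one, hence positive: in
effect a probability measure. Testing `‖id - Π* ∘ T‖ ≤ 1` on truncated functions shows that it gives
mass at least 1/2 to every point of the fibre over `x` (`half_le_reFunctional_evalComp`). So a fibre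
has at most two points, and `T` averages over it; over a one-point fibre it is evaluation
(`exists_fibre_partner`). Exchanging the points of each fibre gives `ρ`, with `f ∘ ρ = 2 Π*(T f) -
f`, from which continuity follows by a closed graph argument. If `ρ` were the identity, `id - Π* ∘
T` would vanish, against norm one.

For the second claim, `T h₀ = 0` means that `h₀` is odd under `ρ`, so `h₀²` is the pull-back of `h =
T (h₀²)`, which lies in `A`, and `y ↦ (Π y, h₀ y)` is the required homeomorphism. -/

/-- A real-valued continuous function, regarded as a complex-valued one. -/
def complexify {Y : Type*} [TopologicalSpace Y] (g : C(Y, ℝ)) : C(Y, ℂ) :=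
  ⟨fun y => (g y : ℂ), by fun_prop⟩

/-! ### Unital norm-one functionals and positivity -/

noncomputable section Functional

variable {Y : Type*} [TopologicalSpace Y]

/-- The real functional `g ↦ re (φ g)` induced on `C(Y, ℝ)` by a functional on `C(Y, ℂ)`. -/
def reFunctional (φ : C(Y, ℂ) →ₗ[ℂ] ℂ) : C(Y, ℝ) →ₗ[ℝ] ℝ where
  toFun g := (φ (complexify g)).re
  map_add' f g := by
    have : complexify (f + g) = complexify f + complexify g := by ext; simp [complexify]
    rw [this, map_add, Complex.add_re]
  map_smul' c g := by
    have : complexify (c • g) = (c : ℂ) • complexify g := by ext; simp [complexify]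
    rw [this, map_smul]; simp

theorem reFunctional_one {φ : C(Y, ℂ) →ₗ[ℂ] ℂ} (h1 : φ 1 = 1) : reFunctional φ 1 = 1 := by
  have : complexify (1 : C(Y, ℝ)) = 1 := by ext; simp [complexify]
  change (φ (complexify 1)).re = 1
  rw [this, h1, Complex.one_re]

theorem map_mono_of_nonneg {L : C(Y, ℝ) →ₗ[ℝ] ℝ} (hL : ∀ g : C(Y, ℝ), (∀ y, 0 ≤ g y) → 0 ≤ L g)
    {f g : C(Y, ℝ)} (h : ∀ y, f y ≤ g y) : L f ≤ L g := by
  have := hL (g - f) fun y => by simpa using h y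
  rw [map_sub] at this
  linarith

variable [CompactSpace Y]

/-- Adding `i t` to `g` shifts the imaginary part by `t` but makes the squared norm at most `‖g‖² +
t²`; a nonzero `b` would violate this for suitable `t`. -/
theorem im_apply_complexify {φ : C(Y, ℂ) →ₗ[ℂ] ℂ} (h1 : φ 1 = 1) (hφ : ∀ f, ‖φ f‖ ≤ ‖f‖)
    (g : C(Y, ℝ)) : (φ (complexify g)).im = 0 := by
  set b := (φ (complexify g)).im with hb
  have key : ∀ t : ℝ, (b + t) ^ 2 ≤ ‖g‖ ^ 2 + t ^ 2 := by
    intro t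
    have h2 : φ (complexify g + ((t : ℂ) * Complex.I) • (1 : C(Y, ℂ)))
        = φ (complexify g) + t * Complex.I := by
      rw [map_add, map_smul, h1]; simp
    have h3 : ‖complexify g + ((t : ℂ) * Complex.I) • (1 : C(Y, ℂ))‖
        ≤ √(‖g‖ ^ 2 + t ^ 2) := by
      refine (ContinuousMap.norm_le _ (Real.sqrt_nonneg _)).2 fun y => ?_
      have : (complexify g + ((t : ℂ) * Complex.I) • (1 : C(Y, ℂ))) y
          = (g y : ℂ) + t * Complex.I := by simp [complexify]
      rw [this, Complex.norm_add_mul_I]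
      refine Real.sqrt_le_sqrt ?_
      have := g.norm_coe_le_norm y
      rw [Real.norm_eq_abs] at this
      have := sq_le_sq' (by linarith [neg_abs_le (g y), norm_nonneg g, abs_nonneg (g y)]) this
      rw [sq_abs] at this
      linarith
    have h4 := (hφ _).trans h3
    rw [h2] at h4
    have h5 : |b + t| ≤ ‖φ (complexify g) + t * Complex.I‖ := by
      have := Complex.abs_im_le_norm (φ (complexify g) + t * Complex.I)
      simpa [hb] using this
    have h6 := h5.trans h4
    have h7 : 0 ≤ ‖g‖ ^ 2 + t ^ 2 := by positivity
    calc (b + t) ^ 2 = |b + t| ^ 2 := (sq_abs _).symm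
      _ ≤ √(‖g‖ ^ 2 + t ^ 2) ^ 2 := pow_le_pow_left₀ (abs_nonneg _) h6 2
      _ = _ := Real.sq_sqrt h7
  by_contra hne
  -- This `t` makes the cross term `2 b t` exceed `‖g‖²`.
  have := key ((‖g‖ ^ 2 + 1) / (2 * b))
  have e : 2 * b * ((‖g‖ ^ 2 + 1) / (2 * b)) = ‖g‖ ^ 2 + 1 := by field_simp
  nlinarith [sq_nonneg b]

theorem norm_complexify (g : C(Y, ℝ)) : ‖complexify g‖ = ‖g‖ := by
  refine le_antisymm ?_ ?_
  · refine (ContinuousMap.norm_le _ (norm_nonneg _)).2 fun y => ?_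
    simpa [complexify] using g.norm_coe_le_norm y
  · refine (ContinuousMap.norm_le _ (norm_nonneg _)).2 fun y => ?_
    simpa [complexify] using (complexify g).norm_coe_le_norm y

theorem apply_complexify {φ : C(Y, ℂ) →ₗ[ℂ] ℂ} (h1 : φ 1 = 1) (hφ : ∀ f, ‖φ f‖ ≤ ‖f‖)
    (g : C(Y, ℝ)) : φ (complexify g) = (reFunctional φ g : ℂ) :=
  Complex.ext rfl (by simpa using im_apply_complexify h1 hφ g)

theorem abs_reFunctional_le {φ : C(Y, ℂ) →ₗ[ℂ] ℂ} (hφ : ∀ f, ‖φ f‖ ≤ ‖f‖) (g : C(Y, ℝ)) :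
    |reFunctional φ g| ≤ ‖g‖ :=
  (Complex.abs_re_le_norm _).trans ((hφ _).trans_eq (norm_complexify g))

theorem apply_eq_of_reFunctional {φ : C(Y, ℂ) →ₗ[ℂ] ℂ} (h1 : φ 1 = 1) (hφ : ∀ f, ‖φ f‖ ≤ ‖f‖)
    {y z : Y} (h : ∀ g, reFunctional φ g = (g y + g z) / 2) (f : C(Y, ℂ)) :
    φ f = (f y + f z) / 2 := by
  let a : C(Y, ℝ) := ⟨fun y => (f y).re, by fun_prop⟩
  let b : C(Y, ℝ) := ⟨fun y => (f y).im, by fun_prop⟩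
  have e : f = complexify a + Complex.I • complexify b := by
    ext w
    change f w = ((f w).re : ℂ) + Complex.I * ((f w).im : ℂ)
    rw [mul_comm, Complex.re_add_im]
  have ew : ∀ w, f w = (a w : ℂ) + Complex.I * (b w : ℂ) := fun w => congrArg (· w) e
  rw [ew y, ew z]
  conv_lhs => rw [e]
  rw [map_add, map_smul, apply_complexify h1 hφ, apply_complexify h1 hφ, h, h, smul_eq_mul]
  push_cast
  ring

/-- For `g ≥ 0` the function `‖g‖ - g` still has norm at most `‖g‖`, so `‖g‖ - L g ≤ ‖g‖`. -/
theorem nonneg_of_abs_le_norm {L : C(Y, ℝ) →ₗ[ℝ] ℝ} (h1 : L 1 = 1) (hL : ∀ g, |L g| ≤ ‖g‖)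
    {g : C(Y, ℝ)} (hg : ∀ y, 0 ≤ g y) : 0 ≤ L g := by
  have h : ‖‖g‖ • (1 : C(Y, ℝ)) - g‖ ≤ ‖g‖ := by
    refine (ContinuousMap.norm_le _ (norm_nonneg _)).2 fun y => ?_
    have := g.norm_coe_le_norm y
    rw [Real.norm_eq_abs, abs_of_nonneg (hg y)] at this
    simp only [ContinuousMap.coe_sub, ContinuousMap.coe_smul, ContinuousMap.coe_one,
      Pi.sub_apply, Pi.smul_apply, Pi.one_apply, smul_eq_mul, mul_one, Real.norm_eq_abs]
    rw [abs_of_nonneg (by linarith)]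
    linarith [hg y]
  have h2 := (le_abs_self _).trans ((hL _).trans h)
  rw [map_sub, map_smul, h1, smul_eq_mul] at h2
  linarith

/-- A positive functional that vanishes at `1` is zero. -/
theorem eq_zero_of_map_one_eq_zero {L : C(Y, ℝ) →ₗ[ℝ] ℝ}
    (hL : ∀ g : C(Y, ℝ), (∀ y, 0 ≤ g y) → 0 ≤ L g) (h1 : L 1 = 0) (g : C(Y, ℝ)) : L g = 0 := by
  have b : ∀ y, |g y| ≤ ‖g‖ := fun y => g.norm_coe_le_norm y
  have hu := map_mono_of_nonneg hL (f := g) (g := ‖g‖ • 1) fun y => by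
    simpa using (abs_le.1 (b y)).2
  have hl := map_mono_of_nonneg hL (f := (-‖g‖) • 1) (g := g) fun y => by
    simpa using (abs_le.1 (b y)).1
  simp only [map_smul, h1, smul_zero] at hu hl
  exact le_antisymm hu hl

variable [T2Space Y]

theorem exists_urysohn_point {K : Set Y} (hK : IsClosed K) {y : Y} (hy : y ∉ K) :
    ∃ u : C(Y, ℝ), u y = 0 ∧ (∀ z ∈ K, u z = 1) ∧ ∀ z, 0 ≤ u z ∧ u z ≤ 1 := by
  obtain ⟨u, h0, h1, h⟩ := exists_continuous_zero_one_of_isClosed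
    (isClosed_singleton (x := y)) hK (Set.disjoint_singleton_left.2 hy)
  exact ⟨u, h0 rfl, fun z hz => h1 hz, fun z => h z⟩

/-- A positive functional which dominates half of two distinct point evaluations is their mean. -/
theorem eq_mean_of_half_le {L : C(Y, ℝ) →ₗ[ℝ] ℝ} (h1 : L 1 = 1) {y z : Y} (hyz : y ≠ z)
    (hy : ∀ g : C(Y, ℝ), (∀ w, 0 ≤ g w) → g y / 2 ≤ L g)
    (hz : ∀ g : C(Y, ℝ), (∀ w, 0 ≤ g w) → g z / 2 ≤ L g) (g : C(Y, ℝ)) :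
    L g = (g y + g z) / 2 := by
  obtain ⟨u, uy, uz, hu⟩ := exists_urysohn_point (isClosed_singleton (x := z)) (y := y) (by simpa)
  have uz := uz z rfl
  let ev : Y → C(Y, ℝ) →ₗ[ℝ] ℝ := fun w =>
    { toFun := fun g => g w, map_add' := fun _ _ => rfl, map_smul' := fun _ _ => rfl }
  -- The remainder after removing both half-masses vanishes at 1; it is positive because `u` splits
  -- `g` into a part seen only at `z` and a part seen only at `y`.
  have h := eq_zero_of_map_one_eq_zero (L := L - (2⁻¹ : ℝ) • (ev y + ev z)) ?_ ?_ g
  · simp only [LinearMap.sub_apply, LinearMap.smul_apply, LinearMap.add_apply, smul_eq_mul] at h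
    change L g - 2⁻¹ * (g y + g z) = 0 at h
    linarith
  · intro g hg
    have a := hz (u * g) fun w => mul_nonneg (hu w).1 (hg w)
    have b := hy ((1 - u) * g) fun w => mul_nonneg (sub_nonneg.2 (hu w).2) (hg w)
    have e : L g = L (u * g) + L ((1 - u) * g) := by rw [← map_add]; congr 1; ring
    simp only [ContinuousMap.mul_apply, ContinuousMap.sub_apply, ContinuousMap.one_apply, uz, uy]
      at a b
    change 0 ≤ L g - 2⁻¹ * (g y + g z)
    linarith
  · change L 1 - 2⁻¹ * (1 + 1) = 0
    rw [h1]; norm_num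

/-- A functional dominates half of at most two point evaluations. -/
theorem eq_or_eq_of_half_le {L : C(Y, ℝ) →ₗ[ℝ] ℝ} (h1 : L 1 = 1) {y z w : Y} (hyz : y ≠ z)
    (hy : ∀ g : C(Y, ℝ), (∀ w, 0 ≤ g w) → g y / 2 ≤ L g)
    (hz : ∀ g : C(Y, ℝ), (∀ w, 0 ≤ g w) → g z / 2 ≤ L g)
    (hw : ∀ g : C(Y, ℝ), (∀ w, 0 ≤ g w) → g w / 2 ≤ L g) : w = y ∨ w = z := by
  by_contra! h
  obtain ⟨u, u0, u1, hu⟩ := exists_urysohn_point (K := {y, z}) (Set.toFinite _).isClosed (y := w)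
    (by simpa using h)
  -- A third half-mass is impossible: `1 - u` is 1 at `w` and 0 at `y` and `z`, giving 1/2 ≤ 0.
  have a := hw (1 - u) fun v => sub_nonneg.2 (hu v).2
  rw [eq_mean_of_half_le h1 hyz hy hz] at a
  simp only [ContinuousMap.sub_apply, ContinuousMap.one_apply, u0, u1 y (by simp),
    u1 z (by simp)] at a
  norm_num at a

omit [T2Space Y] in
/-- A positive unital functional which extends evaluation at a point `x` with a one-point fibre is
evaluation at the point of the fibre. -/
theorem eq_eval_of_fibre_singleton {X : Type*} [TopologicalSpace X] [CompactSpace X] [T2Space X]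
    (p : C(Y, X)) {L : C(Y, ℝ) →ₗ[ℝ] ℝ} (h1 : L 1 = 1)
    (hL : ∀ g : C(Y, ℝ), (∀ y, 0 ≤ g y) → 0 ≤ L g) {y : Y}
    (hp : ∀ u : C(X, ℝ), L (u.comp p) = u (p y)) (hy : ∀ z, p z = p y → z = y) (g : C(Y, ℝ)) :
    L g = g y := by
  suffices h : ∀ ε > 0, |L (g - g y • 1)| ≤ ε by
    have := abs_nonpos_iff.1 (le_of_forall_pos_le_add fun ε hε =>
      (h ε hε).trans_eq (zero_add ε).symm)
    rw [map_sub, map_smul, h1, smul_eq_mul, mul_one] at this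
    linarith
  intro ε hε
  set f : C(Y, ℝ) := g - g y • 1 with hf
  have fy : f y = 0 := by simp [hf]
  have hK : IsClosed (p '' {z | ε ≤ |f z|}) :=
    ((isClosed_le continuous_const (by fun_prop)).isCompact.image p.continuous).isClosed
  obtain ⟨u, u0, u1, hu⟩ := exists_urysohn_point hK (y := p y) (by
    rintro ⟨z, hz, hzy⟩
    have : ε ≤ |f z| := hz
    rw [hy z hzy, fy, abs_zero] at this
    linarith)
  -- The majorant is a constant plus a pull-back from `X`, so `L` is known on it: its value is `ε`.
  have bd : ∀ z, |f z| ≤ ε + ‖f‖ * u (p z) := by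
    intro z
    by_cases hz : ε ≤ |f z|
    · rw [u1 _ ⟨z, hz, rfl⟩]
      have : |f z| ≤ ‖f‖ := f.norm_coe_le_norm z
      linarith
    · have := mul_nonneg (norm_nonneg f) (hu (p z)).1
      linarith
  have e : L (ε • 1 + ‖f‖ • u.comp p) = ε := by
    rw [map_add, map_smul, map_smul, h1, hp, u0]; simp
  refine abs_le.2 ⟨?_, ?_⟩
  · rw [← e, ← map_neg]
    exact map_mono_of_nonneg hL fun z => by
      have := (abs_le.1 (bd z)).1
      simpa [add_comm] using this
  · rw [← e]
    exact map_mono_of_nonneg hL fun z => by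
      have := (abs_le.1 (bd z)).2
      simpa using this

end Functional

/-! ### Fibres of `Π` and the involution -/

noncomputable section Involution

variable {X Y : Type*} [TopologicalSpace X] [CompactSpace X] [TopologicalSpace Y] [CompactSpace Y]

/-- Evaluation of `T f` at the point `x`, as a functional of `f`. -/
def evalComp (T : C(Y, ℂ) →L[ℂ] C(X, ℂ)) (x : X) : C(Y, ℂ) →ₗ[ℂ] ℂ where
  toFun f := T f x
  map_add' f g := by simp
  map_smul' c f := by simp

variable {A : Subalgebra ℂ C(X, ℂ)} {B : Subalgebra ℂ C(Y, ℂ)} {p : C(Y, X)}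
  {T : C(Y, ℂ) →L[ℂ] C(X, ℂ)}

theorem evalComp_one (h : IsGeneralisedColeExtension A B p T) (x : X) : evalComp T x 1 = 1 :=
  congrArg (· x) h.map_one

theorem norm_evalComp_le (h : IsGeneralisedColeExtension A B p T) (x : X) (f : C(Y, ℂ)) :
    ‖evalComp T x f‖ ≤ ‖f‖ :=
  ((T f).norm_coe_le_norm x).trans (by simpa [h.norm_eq_one] using T.le_opNorm f)

theorem reFunctional_evalComp_nonneg (h : IsGeneralisedColeExtension A B p T) (x : X)
    (g : C(Y, ℝ)) (hg : ∀ y, 0 ≤ g y) : 0 ≤ reFunctional (evalComp T x) g :=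
  nonneg_of_abs_le_norm (reFunctional_one (evalComp_one h x))
    (abs_reFunctional_le (norm_evalComp_le h x)) hg

theorem apply_pullback (h : IsGeneralisedColeExtension A B p T) (f : C(X, ℂ)) :
    T (f.comp p) = f :=
  congrArg (· f) h.comp_pullback

theorem reFunctional_evalComp_comp (h : IsGeneralisedColeExtension A B p T) (x : X)
    (u : C(X, ℝ)) : reFunctional (evalComp T x) (u.comp p) = u x := by
  change (T ((complexify u).comp p) x).re = u x
  rw [apply_pullback h]; rfl

theorem half_le_reFunctional_evalComp (h : IsGeneralisedColeExtension A B p T)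
    (hn : ‖ContinuousLinearMap.id ℂ C(Y, ℂ) - (pullback p).comp T‖ ≤ 1) (y : Y)
    (g : C(Y, ℝ)) (hg : ∀ w, 0 ≤ g w) : g y / 2 ≤ reFunctional (evalComp T (p y)) g := by
  set L := reFunctional (evalComp T (p y)) with hL
  have h1 : L 1 = 1 := reFunctional_one (evalComp_one h _)
  have bound : ∀ f : C(Y, ℝ), f y - L f ≤ ‖f‖ := by
    intro f
    have a := (ContinuousLinearMap.id ℂ C(Y, ℂ) - (pullback p).comp T).le_of_opNorm_le hn
      (complexify f)
    rw [one_mul, norm_complexify] at a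
    have b := (ContinuousMap.norm_coe_le_norm _ y).trans a
    exact (Complex.re_le_norm _).trans b
  -- After truncation at `g y`, the function `2m - g y` has norm at most `g y` and attains `g y` at
  -- `y`; the bound then reads `L m ≥ g y / 2`.
  let m : C(Y, ℝ) := g ⊓ g y • 1
  have hm : ∀ w, m w = min (g w) (g y) := fun w => by simp [m]
  have b : ‖(2 : ℝ) • m - g y • 1‖ ≤ g y := by
    refine (ContinuousMap.norm_le _ (hg y)).2 fun w => ?_
    have e : ((2 : ℝ) • m - g y • 1) w = 2 * min (g w) (g y) - g y := by simp [hm]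
    rw [e, Real.norm_eq_abs, abs_le]
    have := le_min (hg w) (hg y)
    have := min_le_right (g w) (g y)
    constructor <;> linarith
  have c := (bound _).trans b
  rw [map_sub, map_smul, map_smul, h1] at c
  have e : ((2 : ℝ) • m - g y • 1) y = g y := by
    have := hm y
    rw [min_self] at this
    simp [this]; ring
  rw [e] at c
  have d : L m ≤ L g := map_mono_of_nonneg (reFunctional_evalComp_nonneg h _) fun w => by
    rw [hm]; exact min_le_left _ _
  simp only [smul_eq_mul, mul_one] at c
  linarith

theorem exists_fibre_partner [T2Space X] [T2Space Y] (h : IsGeneralisedColeExtension A B p T)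
    (hn : ‖ContinuousLinearMap.id ℂ C(Y, ℂ) - (pullback p).comp T‖ ≤ 1) (y : Y) :
    ∃ z, (∀ w, p w = p y ↔ w = y ∨ w = z) ∧ ∀ f, T f (p y) = (f y + f z) / 2 := by
  have h1 := evalComp_one h (p y)
  have hle := norm_evalComp_le h (p y)
  have half : ∀ w, p w = p y → ∀ g : C(Y, ℝ), (∀ v, 0 ≤ g v) →
      g w / 2 ≤ reFunctional (evalComp T (p y)) g := fun w hw g hg =>
    hw ▸ half_le_reFunctional_evalComp h hn w g hg
  by_cases hy : ∀ w, p w = p y → w = y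
  · refine ⟨y, fun w => ⟨fun hw => .inl (hy w hw), by rintro (rfl | rfl) <;> rfl⟩, fun f => ?_⟩
    refine apply_eq_of_reFunctional h1 hle (fun g => ?_) f
    rw [eq_eval_of_fibre_singleton p (reFunctional_one h1) (reFunctional_evalComp_nonneg h _)
      (reFunctional_evalComp_comp h _) hy]
    ring
  · push Not at hy
    obtain ⟨z, hz, hzy⟩ := hy
    refine ⟨z, fun w => ⟨fun hw => ?_, by rintro (rfl | rfl) <;> [rfl; exact hz]⟩, fun f => ?_⟩
    · exact eq_or_eq_of_half_le (reFunctional_one h1) hzy.symm (half y rfl) (half z hz) (half w hw)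
    · exact apply_eq_of_reFunctional h1 hle
        (eq_mean_of_half_le (reFunctional_one h1) hzy.symm (half y rfl) (half z hz)) f

theorem eq_of_forall_apply_eq [T2Space Y] {y z : Y} (h : ∀ f : C(Y, ℂ), f y = f z) : y = z := by
  by_contra hne
  obtain ⟨u, u0, u1, -⟩ := exists_urysohn_point (isClosed_singleton (x := z)) (y := y) (by simpa)
  have := h (complexify u)
  simp [complexify, u0, u1 z rfl] at this

/-- A generalised Cole extension with `‖id - Π* ∘ T‖ ≤ 1` carries an involution whose orbits are
the fibres of `Π` and whose averaging operator is `T`. -/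
theorem exists_involution [T2Space X] [T2Space Y] (h : IsGeneralisedColeExtension A B p T)
    (hn : ‖ContinuousLinearMap.id ℂ C(Y, ℂ) - (pullback p).comp T‖ ≤ 1) :
    ∃ ρ : Y ≃ₜ Y, (∀ y, ρ (ρ y) = y) ∧ (∀ y w, p w = p y ↔ w = y ∨ w = ρ y) ∧
      ∀ f y, T f (p y) = (f y + f (ρ y)) / 2 := by
  choose r hr hT using exists_fibre_partner h hn
  have hp : ∀ y, p (r y) = p y := fun y => (hr y _).2 (.inr rfl)
  -- `y` and `r y` lie over the same point, so their two averaging formulas agree.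
  have inv : ∀ y, r (r y) = y := fun y => eq_of_forall_apply_eq fun f => by
    have a := hT y f
    rw [← hp y, hT (r y) f] at a
    linear_combination 2 * a
  have e : ∀ (f : C(Y, ℂ)) y, f (r y) = 2 * T f (p y) - f y := fun f y => by rw [hT]; ring
  -- Continuous functions separate points, so the graph is cut out by closed conditions; compactness
  -- of `Y` turns this into continuity of `r`.
  have graph : IsClosed {x : Y × Y | r x.1 = x.2} := by
    have : {x : Y × Y | r x.1 = x.2} =
        ⋂ f : C(Y, ℂ), {x | f x.2 = 2 * T f (p x.1) - f x.1} := by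
      ext x
      simp only [Set.mem_ofPred_eq, Set.mem_iInter, ← e]
      exact ⟨fun hx f => by rw [hx], fun hx => (eq_of_forall_apply_eq hx).symm⟩
    rw [this]
    exact isClosed_iInter fun f => isClosed_eq (by fun_prop) (by fun_prop)
  have cont : Continuous r := by
    refine continuous_iff_isClosed.2 fun K hK => ?_
    have : r ⁻¹' K = Prod.fst '' ({x : Y × Y | r x.1 = x.2} ∩ Prod.snd ⁻¹' K) := by
      ext y
      constructor
      · exact fun hy => ⟨(y, r y), ⟨rfl, hy⟩, rfl⟩
      · rintro ⟨⟨_, w⟩, ⟨hw, hK⟩, rfl⟩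
        exact Set.mem_preimage.2 (hw ▸ hK)
    rw [this]
    exact isClosedMap_fst_of_compactSpace _ (graph.inter (hK.preimage continuous_snd))
  exact ⟨⟨⟨r, r, inv, inv⟩, cont, cont⟩, inv, hr, fun f y => hT y f⟩

end Involution

/-! ### Haar measure and the group of order two -/

section TwoElementGroup

open MeasureTheory

theorem integral_normalisedHaar_of_two {G : Type*} [Group G] [TopologicalSpace G]
    [IsTopologicalGroup G] [CompactSpace G] [DiscreteTopology G] {a : G} (ha : a ≠ 1)
    (hG : ∀ g : G, g = 1 ∨ g = a) (f : G → ℂ) :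
    @integral G ℂ _ _ (borel G) (normalisedHaar G) f = (f 1 + f a) / 2 := by
  classical
  let : MeasurableSpace G := borel G
  have : BorelSpace G := ⟨rfl⟩
  let : Fintype G := ⟨{1, a}, fun g => by simpa using hG g⟩
  let μ : Measure G := Measure.haarMeasure (⊤ : TopologicalSpace.PositiveCompacts G)
  have : IsProbabilityMeasure μ := ⟨Measure.haarMeasure_self (K₀ := ⊤)⟩
  change ∫ g, f g ∂μ = _
  -- Translation by `a` carries one singleton to the other, so each has mass 1/2.
  have hμ : μ.real {a} = μ.real {1} := by
    have := measure_preimage_mul μ a {a}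
    rw [show (fun h => a * h) ⁻¹' {a} = {(1 : G)} by ext; simp] at this
    exact congrArg ENNReal.toReal this.symm
  have hu : (Finset.univ : Finset G) = {1, a} := rfl
  have h1 : μ.real {1} + μ.real {a} = 1 := by
    have := sum_measureReal_singleton (μ := μ) (Finset.univ : Finset G)
    rw [Finset.coe_univ, probReal_univ, hu, Finset.sum_pair ha.symm] at this
    exact this
  rw [integral_fintype (.of_finite), hu, Finset.sum_pair ha.symm, hμ]
  have : μ.real {1} = 1 / 2 := by linarith
  rw [this]
  simp only [Complex.real_smul]
  push_cast
  ring

/-- The two-element group of self-homeomorphisms generated by an involution. -/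
def involutionSubgroup {Y : Type*} [TopologicalSpace Y] (ρ : Y ≃ₜ Y) (h : ∀ y, ρ (ρ y) = y) :
    Subgroup (Y ≃ₜ Y) where
  carrier := {Homeomorph.refl Y, ρ}
  one_mem' := .inl rfl
  mul_mem' := by
    rintro a b (rfl | rfl) (rfl | rfl)
    · exact .inl rfl
    · exact .inr rfl
    · exact .inr rfl
    · exact .inl (Homeomorph.ext h)
  inv_mem' := by
    rintro a (rfl | rfl)
    · exact .inl rfl
    · exact .inr (Homeomorph.ext fun y => (a.symm_apply_eq.2 (h y).symm))

theorem isImplementedBy_involutionSubgroup {X Y : Type*} [TopologicalSpace X] [CompactSpace X]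
    [TopologicalSpace Y] [CompactSpace Y] {A : Subalgebra ℂ C(X, ℂ)} {B : Subalgebra ℂ C(Y, ℂ)}
    {p : C(Y, X)} {T : C(Y, ℂ) →L[ℂ] C(X, ℂ)} (h : IsGeneralisedColeExtension A B p T)
    {ρ : Y ≃ₜ Y} (hρ : ρ ≠ Homeomorph.refl Y) (hinv : ∀ y, ρ (ρ y) = y)
    (hp : ∀ y w, p w = p y ↔ w = y ∨ w = ρ y) (hT : ∀ f y, T f (p y) = (f y + f (ρ y)) / 2) :
    letI : TopologicalSpace (involutionSubgroup ρ hinv) := ⊥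
    IsImplementedBy A B p T (involutionSubgroup ρ hinv) := by
  let : TopologicalSpace (involutionSubgroup ρ hinv) := ⊥
  have : DiscreteTopology (involutionSubgroup ρ hinv) := ⟨rfl⟩
  have : Finite (involutionSubgroup ρ hinv) :=
    Set.Finite.to_subtype (Set.toFinite {Homeomorph.refl Y, ρ})
  let a : involutionSubgroup ρ hinv := ⟨ρ, .inr rfl⟩
  have ha : a ≠ 1 := fun e => hρ (congrArg Subtype.val e)
  have hG : ∀ g : involutionSubgroup ρ hinv, g = 1 ∨ g = a := by
    rintro ⟨g, rfl | rfl⟩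
    · exact .inl rfl
    · exact .inr rfl
  refine ⟨h, inferInstance, inferInstance, inferInstance, ⟨?_⟩, fun y => ?_, fun f _ y => ?_⟩
  · exact continuous_prod_of_discrete_left.2 fun g => g.1.continuous
  · ext w
    refine Iff.trans ?_ (hp y w).symm
    constructor
    · rintro ⟨g, rfl⟩
      rcases hG g with rfl | rfl
      · exact .inl rfl
      · exact .inr rfl
    · rintro (rfl | rfl)
      · exact ⟨1, rfl⟩
      · exact ⟨a, rfl⟩
  · rw [integral_normalisedHaar_of_two ha hG, hT]
    rfl

end TwoElementGroup

/-! ### Adjoining a square root -/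

section SquareRoot

theorem mem_coleSpace_sqMinus {X : Type*} [TopologicalSpace X] {A : Subalgebra ℂ C(X, ℂ)} (h : A)
    (x : X × ℂ) : x ∈ coleSpace (sqMinus h) ↔ x.2 ^ 2 = (h : C(X, ℂ)) x.1 := by
  change Polynomial.eval₂ _ _ _ = 0 ↔ _
  rw [sqMinus, Polynomial.eval₂_add, Polynomial.eval₂_pow, Polynomial.eval₂_X, Polynomial.eval₂_C]
  change x.2 ^ 2 + -((h : C(X, ℂ)) x.1) = 0 ↔ _
  rw [← sub_eq_add_neg, sub_eq_zero]

theorem image_comp_topologicalClosure_adjoin {Y Z : Type*} [TopologicalSpace Y]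
    [TopologicalSpace Z] (ψ : Y ≃ₜ Z) (S : Set C(Z, ℂ)) [LocallyCompactSpace Y]
    [LocallyCompactSpace Z] :
    (fun f : C(Z, ℂ) => f.comp (ψ : C(Y, Z))) ''
        ((Algebra.adjoin ℂ S).topologicalClosure : Set C(Z, ℂ)) =
      ((Algebra.adjoin ℂ ((fun f : C(Z, ℂ) => f.comp (ψ : C(Y, Z))) '' S)).topologicalClosure :
        Set C(Y, ℂ)) := by
  let F : C(Z, ℂ) →ₐ[ℂ] C(Y, ℂ) := ContinuousMap.compRightAlgHom ℂ ℂ (ψ : C(Y, Z))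
  have a := (ψ.symm.arrowCongr (Homeomorph.refl ℂ)).image_closure
    (Algebra.adjoin ℂ S : Set C(Z, ℂ))
  have b := congrArg (fun A : Subalgebra ℂ C(Y, ℂ) => (A : Set C(Y, ℂ))) (F.map_adjoin S)
  rw [Subalgebra.topologicalClosure_coe, Subalgebra.topologicalClosure_coe]
  exact a.trans (congrArg closure b)

theorem separates_of_topologicalClosure_adjoin {Y : Type*} [TopologicalSpace Y]
    [LocallyCompactSpace Y] {S : Set C(Y, ℂ)} {y z : Y} (h : ∀ f ∈ S, f y = f z) :
    ∀ f ∈ (Algebra.adjoin ℂ S).topologicalClosure, f y = f z := by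
  let E : Subalgebra ℂ C(Y, ℂ) :=
    AlgHom.equalizer (ContinuousMap.evalAlgHom ℂ ℂ y) (ContinuousMap.evalAlgHom ℂ ℂ z)
  have hE : IsClosed (E : Set C(Y, ℂ)) :=
    isClosed_eq (continuous_eval_const y) (continuous_eval_const z)
  exact Subalgebra.topologicalClosure_minimal (t := E) (Algebra.adjoin_le h) hE

theorem exists_homeomorph_coleSpace {X Y : Type*} [TopologicalSpace X] [CompactSpace X] [T2Space X]
    [TopologicalSpace Y] [CompactSpace Y] [T2Space Y] {A : Subalgebra ℂ C(X, ℂ)}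
    {B : Subalgebra ℂ C(Y, ℂ)} (hB : B.SeparatesPoints) {p : C(Y, X)}
    {T : C(Y, ℂ) →L[ℂ] C(X, ℂ)} (hGCE : IsGeneralisedColeExtension A B p T) {ρ : Y ≃ₜ Y}
    (hp : ∀ y w, p w = p y ↔ w = y ∨ w = ρ y)
    (hT : ∀ f y, T f (p y) = (f y + f (ρ y)) / 2) {h₀ : C(Y, ℂ)} (hh : h₀ ∈ B) (h0 : T h₀ = 0)
    (hgen : B =
      (Algebra.adjoin ℂ (insert h₀ (pullback p '' (A : Set C(X, ℂ))))).topologicalClosure) :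
    ∃ (h : A) (ψ : Y ≃ₜ coleSpace (sqMinus h)),
      (∀ y, coleProj (sqMinus h) (ψ y) = p y) ∧
      (fun f : C(coleSpace (sqMinus h), ℂ) => f.comp (ψ : C(Y, coleSpace (sqMinus h)))) ''
        (coleExtension (sqMinus h) : Set C(coleSpace (sqMinus h), ℂ)) = (B : Set C(Y, ℂ)) ∧
      ∀ y, coleRoot (sqMinus h) (ψ y) = h₀ y := by
  have odd : ∀ y, h₀ (ρ y) = -h₀ y := fun y => by
    have := hT h₀ y
    rw [h0, ContinuousMap.zero_apply] at this
    linear_combination -2 * this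
  let h : A := ⟨T (h₀ ^ 2), hGCE.image_eq.subset ⟨h₀ ^ 2, pow_mem hh 2, rfl⟩⟩
  have hsq : ∀ y, h₀ y ^ 2 = (h : C(X, ℂ)) (p y) := fun y => by
    change _ = T (h₀ ^ 2) (p y)
    rw [hT, ContinuousMap.pow_apply, ContinuousMap.pow_apply, odd]
    ring
  let F : Y → coleSpace (sqMinus h) := fun y =>
    ⟨(p y, h₀ y), (mem_coleSpace_sqMinus h _).2 (hsq y)⟩
  have hF : Continuous F := by fun_prop
  have inj : Function.Injective F := by
    intro y w e
    have e1 : p w = p y := congrArg (fun z => z.1.1) e.symm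
    have e2 : h₀ y = h₀ w := congrArg (fun z => z.1.2) e
    by_contra hne
    obtain ⟨f, ⟨f, hf, rfl⟩, hfne⟩ := hB hne
    -- If `F` identified two points, all generators of `B`, hence all of `B`, would too.
    refine hfne (separates_of_topologicalClosure_adjoin ?_ f (hgen ▸ hf))
    rintro _ (rfl | ⟨g, -, rfl⟩)
    · exact e2
    · exact congrArg g e1.symm
  have surj : Function.Surjective F := by
    rintro ⟨⟨x, z⟩, hz⟩
    obtain ⟨y, rfl⟩ := hGCE.surjective x
    -- The two square roots `±h₀ y` are the values of `h₀` at `y` and `ρ y`.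
    have hz' : z ^ 2 = h₀ y ^ 2 := ((mem_coleSpace_sqMinus h _).1 hz).trans (hsq y).symm
    rcases sq_eq_sq_iff_eq_or_eq_neg.1 hz' with rfl | rfl
    · exact ⟨y, rfl⟩
    · exact ⟨ρ y, Subtype.ext (Prod.ext ((hp y _).2 (.inr rfl)) (odd y))⟩
  let ψ : Y ≃ₜ coleSpace (sqMinus h) :=
    Continuous.homeoOfEquivCompactToT2 (f := Equiv.ofBijective F ⟨inj, surj⟩) hF
  refine ⟨h, ψ, fun y => rfl, ?_, fun y => rfl⟩
  rw [coleExtension, image_comp_topologicalClosure_adjoin, Set.image_insert_eq, Set.image_image]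
  exact (congrArg (fun C : Subalgebra ℂ C(Y, ℂ) => (C : Set C(Y, ℂ))) hgen).symm

end SquareRoot

theorem mainTheorem2 {X Y : Type*}
    [TopologicalSpace X] [CompactSpace X] [T2Space X] [Nonempty X]
    [TopologicalSpace Y] [CompactSpace Y] [T2Space Y] [Nonempty Y]
    (A : Subalgebra ℂ C(X, ℂ)) (hA : IsUniformAlgebra A)
    (B : Subalgebra ℂ C(Y, ℂ)) (hB : IsUniformAlgebra B)
    (Pi : C(Y, X)) (T : C(Y, ℂ) →L[ℂ] C(X, ℂ))
    (hGCE : IsGeneralisedColeExtension A B Pi T)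
    (hnorm : ‖ContinuousLinearMap.id ℂ C(Y, ℂ) - (pullback Pi).comp T‖ = 1) :
    (∃ (ρ : Y ≃ₜ Y) (G : Subgroup (Y ≃ₜ Y)),
      ρ ≠ Homeomorph.refl Y ∧ (∀ y, ρ (ρ y) = y) ∧
      (G : Set (Y ≃ₜ Y)) = {Homeomorph.refl Y, ρ} ∧
      -- the finite group `G` carries the discrete topology
      (letI : TopologicalSpace G := ⊥; IsImplementedBy A B Pi T G)) ∧
    (∀ h₀ ∈ B, T h₀ = 0 →
      B = (Algebra.adjoin ℂ (insert h₀ (pullback Pi '' (A : Set C(X, ℂ))))).topologicalClosure →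
      ∃ (h : A) (ψ : Y ≃ₜ coleSpace (sqMinus h)),
        (∀ y, coleProj (sqMinus h) (ψ y) = Pi y) ∧
        (fun f : C(coleSpace (sqMinus h), ℂ) => f.comp (ψ : C(Y, coleSpace (sqMinus h)))) ''
          (coleExtension (sqMinus h) : Set C(coleSpace (sqMinus h), ℂ)) = (B : Set C(Y, ℂ)) ∧
        ∀ y, coleRoot (sqMinus h) (ψ y) = h₀ y) := by
  obtain ⟨ρ, hinv, hp, hT⟩ := exists_involution hGCE hnorm.le
  have hρ : ρ ≠ Homeomorph.refl Y := by
    rintro rfl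
    have hz : ContinuousLinearMap.id ℂ C(Y, ℂ) - (pullback Pi).comp T = 0 := by
      refine ContinuousLinearMap.ext fun f => ContinuousMap.ext fun y => ?_
      change f y - T f (Pi y) = 0
      have e : T f (Pi y) = (f y + f y) / 2 := hT f y
      rw [e]
      ring
    rw [hz, norm_zero] at hnorm
    exact zero_ne_one hnorm
  exact ⟨⟨ρ, involutionSubgroup ρ hinv, hρ, hinv, rfl,
      isImplementedBy_involutionSubgroup hGCE hρ hinv hp hT⟩,
    fun h₀ hh h0 hgen => exists_homeomorph_coleSpace hB.separatesPoints hGCE hp hT hh h0 hgen⟩
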